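/- Let $\mathcal{M}=(S,s_0,\mathcal{A},\mathcal{P},\mathcal{AP},\mathcal{L},\mathcal{R})$ be a Markov decision process with finite state set $S$, initial state $s_0$, finite action set $\mathcal{A}$, nonempty sets $\mathcal{A}(s)\subseteq\mathcal{A}$ of available actions, transition probabilities $\mathcal{P}_{s,a,s'}$, labels $\mathcal{L}(s)\subseteq\mathcal{AP}$ and reward function $\mathcal{R}:S\times\mathcal{A}\to\mathbb{R}$. A policy is a sequence of randomized decision rules, each assigning to every state $s$ a probability distribution on $\mathcal{A}(s)$; let $\Pi_N$ be the set of $N$-stage policies and $\Pi$ the set of $\infty$-stage policies. An incentive design is a sequence $\Gamma=(\gamma_1,\gamma_2,\ldots)$ of functions $\gamma_t:S\times\mathcal{A}\to[0,\infty)$; it depends on the stage, the state of $\mathcal{M}$ and the action only. Let $N\ge 1$ be the agent's planning horizon. A policy $\pi=(\pi_0,\pi_1,\ldots)\in\Pi$, split into $N$-stage blocks $\pi_k$, is called agent-optimal under $\Gamma$ if for every $k\ge 0$ and every $s\in S$ the policy $\pi_k$ maximizes $$J_k(\sigma,\Gamma)(s)=\mathbb{E}_s^{\sigma}\Big[\sum_{t=1}^{N}\big(\mathcal{R}(S_t,A_t)+\gamma_{kN+t}(S_t,A_t)\big)\Big]$$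 over $\sigma\in\Pi_N$. Let $\varphi$ be a syntactically co-safe LTL formula over $\mathcal{AP}$. A pair $(\Gamma,\pi)$ is feasible if $\pi$ is agent-optimal under $\Gamma$ and $\Pr^{\pi}(s_0\models\varphi)=\max_{\sigma\in\Pi}\Pr^{\sigma}(s_0\models\varphi)$. Its cost is $c(\Gamma,\pi)=\mathbb{E}_{s_0}^{\pi}\big[\sum_{t=1}^{\infty}\gamma_t(S_t,A_t)\big]\in[0,\infty]$, and $c^\star$ denotes the infimum of the cost over all feasible pairs. For $\overline{\epsilon}>0$, an incentive design $\Gamma$ is $\overline{\epsilon}$-optimal if some policy is agent-optimal under $\Gamma$ and, for every policy $\pi$ that is agent-optimal under $\Gamma$, the pair $(\Gamma,\pi)$ is feasible with $c(\Gamma,\pi)<\infty$ and $c(\Gamma,\pi)\le c^\star+\overline{\epsilon}$. Suppose that $\mathcal{P}_{s,a,s'}\in\{0,1\}$ for all $s,s'\in S$ and $a\in\mathcal{A}(s)$. Then for every $N\ge 1$, every syntactically co-safe LTL formula $\varphi$ over $\mathcal{AP}$ and every $\overline{\epsilon}>0$ there exists an $\overline{\epsilon}$-optimal incentive design for $\mathcal{M}$.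 -/

import Mathlib

open MeasureTheory ProbabilityTheory
open scoped ENNReal NNReal

namespace IncentiveDesign

/-! ### Markov decision processes -/

/-- A Markov decision process with finite state set `S`, finite action set `A`, and atomic
propositions `AP`. The finset `avail s` is the (nonempty) set of actions available in `s`. -/
structure MDP (S A AP : Type*) [Fintype S] where
  init : S
  avail : S → Finset A
  avail_nonempty : ∀ s, (avail s).Nonempty
  trans : S → A → S → ℝ
  trans_mem : ∀ s a s', trans s a s' ∈ Set.Icc (0 : ℝ) 1
  trans_sum : ∀ s, ∀ a ∈ avail s, ∑ s', trans s a s' = 1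
  label : S → Set AP
  reward : S → A → ℝ

variable {S A AP : Type*} [Fintype S] [Fintype A]

/-- A (randomized) decision rule: in each state, a probability distribution on the available
actions. -/
structure DecisionRule (M : MDP S A AP) where
  prob : S → A → ℝ
  nonneg : ∀ s a, 0 ≤ prob s a
  eq_zero : ∀ s, ∀ a ∉ M.avail s, prob s a = 0
  sum_avail : ∀ s, ∑ a ∈ M.avail s, prob s a = 1

/-- An `∞`-stage policy; index `t` is stage `t + 1`. -/
abbrev Policy (M : MDP S A AP) : Type _ := ℕ → DecisionRule M

/-- An `N`-stage policy; index `t` is stage `t + 1`. -/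
abbrev StagePolicy (M : MDP S A AP) (N : ℕ) : Type _ := Fin N → DecisionRule M

theorem DecisionRule.sum_ofReal {M : MDP S A AP} (d : DecisionRule M) (s : S) :
    ∑ a, ENNReal.ofReal (d.prob s a) = 1 := by
  rw [← ENNReal.ofReal_sum_of_nonneg (fun a _ => d.nonneg s a),
    ← Finset.sum_subset (Finset.subset_univ (M.avail s)) (fun a _ ha => d.eq_zero s a ha),
    d.sum_avail s, ENNReal.ofReal_one]

theorem MDP.sum_ofReal {S A AP : Type*} [Fintype S] (M : MDP S A AP) (s : S) (a : A)
    (ha : a ∈ M.avail s) : ∑ s', ENNReal.ofReal (M.trans s a s') = 1 := by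
  rw [← ENNReal.ofReal_sum_of_nonneg (fun s' _ => (M.trans_mem s a s').1), M.trans_sum s a ha,
    ENNReal.ofReal_one]

/-- The distribution of the action chosen in state `s` by the decision rule `d`. -/
noncomputable def DecisionRule.action {M : MDP S A AP} (d : DecisionRule M) (s : S) : PMF A :=
  PMF.ofFintype (fun a => ENNReal.ofReal (d.prob s a)) (d.sum_ofReal s)

open Classical in
/-- The distribution of the successor of `s` under `a`. Unavailable actions are never taken, and
the value chosen for them is irrelevant. -/
noncomputable def MDP.next {S A AP : Type*} [Fintype S] (M : MDP S A AP) (s : S) (a : A) :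
    PMF S :=
  if ha : a ∈ M.avail s then
    PMF.ofFintype (fun s' => ENNReal.ofReal (M.trans s a s')) (M.sum_ofReal s a ha)
  else PMF.pure s

/-- The joint distribution of `(s, a)` with `a` chosen by `d` in the state `s`. -/
noncomputable def DecisionRule.stateAction {M : MDP S A AP} (d : DecisionRule M) (s : S) :
    PMF (S × A) :=
  (d.action s).map fun a => (s, a)

/-- The distribution of the next state-action pair, if the next decision rule is `d`. -/
noncomputable def stepPMF {M : MDP S A AP} (d : DecisionRule M) (x : S × A) : PMF (S × A) :=
  (M.next x.1 x.2).bind fun s' => d.stateAction s'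

variable [MeasurableSpace S] [DiscreteMeasurableSpace S]
  [MeasurableSpace A] [DiscreteMeasurableSpace A]

/-- The kernel giving the law of the state-action pair at index `n + 1` from the history up to
index `n`. -/
noncomputable def stepKernel {M : MDP S A AP} (π : Policy M) (n : ℕ) :
    Kernel (∀ _ : Finset.Iic n, S × A) (S × A) :=
  (Kernel.ofFunOfCountable fun x : S × A => (stepPMF (π (n + 1)) x).toMeasure).comap
    (fun h => h ⟨n, Finset.mem_Iic.2 le_rfl⟩) (measurable_pi_apply _)

instance {M : MDP S A AP} (π : Policy M) (n : ℕ) : IsMarkovKernel (stepKernel π n) := by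
  constructor
  intro h
  rw [stepKernel, Kernel.comap_apply]
  exact PMF.toMeasure.isProbabilityMeasure (stepPMF (π (n + 1)) _)

/-- The probability measure on infinite state-action sequences generated by the policy `π` from
the state `s`. -/
noncomputable def pathMeasure {M : MDP S A AP} (π : Policy M) (s : S) : Measure (ℕ → S × A) :=
  Kernel.trajMeasure (X := fun _ => S × A) ((π 0).stateAction s).toMeasure (stepKernel π)

/-! ### Syntactically co-safe LTL -/

/-- Syntactically co-safe LTL formulae over `AP`: negation is applied to atomic propositions
only, and the temporal operators are next, until and eventually. -/
inductive SCLTL (AP : Type*) where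
  | tt : SCLTL AP
  | atom (p : AP) : SCLTL AP
  | natom (p : AP) : SCLTL AP
  | and (φ ψ : SCLTL AP) : SCLTL AP
  | or (φ ψ : SCLTL AP) : SCLTL AP
  | next (φ : SCLTL AP) : SCLTL AP
  | until (φ ψ : SCLTL AP) : SCLTL AP
  | eventually (φ : SCLTL AP) : SCLTL AP

/-- Satisfaction of a formula by an infinite word over `2^AP`. -/
def SCLTL.Sat {AP : Type*} : SCLTL AP → (ℕ → Set AP) → Prop
  | .tt, _ => True
  | .atom p, w => p ∈ w 0
  | .natom p, w => p ∉ w 0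
  | .and φ ψ, w => φ.Sat w ∧ ψ.Sat w
  | .or φ ψ, w => φ.Sat w ∨ ψ.Sat w
  | .next φ, w => φ.Sat fun k => w (k + 1)
  | .until φ ψ, w =>
      ∃ j, (ψ.Sat fun k => w (k + j)) ∧ ∀ i < j, φ.Sat fun k => w (k + i)
  | .eventually φ, w => ∃ j, φ.Sat fun k => w (k + j)

/-- The probability that the word generated from the initial state under `π` satisfies `φ`. -/
noncomputable def satProb (M : MDP S A AP) (φ : SCLTL AP) (π : Policy M) : ℝ≥0∞ :=
  pathMeasure π M.init {ω | φ.Sat fun k => M.label (ω k).1}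

/-! ### Incentive designs -/

/-- An incentive design: nonnegative payments depending only on the stage, the state and the
action; index `t` is stage `t + 1`. -/
abbrev Incentive (S A : Type*) : Type _ := ℕ → S → A → ℝ≥0

/-- The agent's `k`-th objective: the expected total of rewards and incentives over `N` stages
from `s`, with the incentives of the `k`-th block of `N` stages. The policy is extended beyond
its `N` stages only to index the path measure; the integrand does not depend on this. -/
noncomputable def objective (M : MDP S A AP) (N : ℕ) [NeZero N] (k : ℕ) (π : StagePolicy M N)
    (Γ : Incentive S A) (s : S) : ℝ :=
  ∫ ω, ∑ t ∈ Finset.range N,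
    (M.reward (ω t).1 (ω t).2 + (Γ (k * N + t) (ω t).1 (ω t).2 : ℝ))
    ∂(pathMeasure (fun t => π (Fin.ofNat N t)) s)

/-- The `k`-th block of `N` stages of an `∞`-stage policy. -/
def block {M : MDP S A AP} (N : ℕ) (π : Policy M) (k : ℕ) : StagePolicy M N :=
  fun t => π (k * N + t)

/-- `π` is an optimal policy of the agent under `Γ`: each block of `N` stages maximizes the
corresponding objective from every state. -/
def AgentOptimal (M : MDP S A AP) (N : ℕ) [NeZero N] (Γ : Incentive S A) (π : Policy M) : Prop :=
  ∀ (k : ℕ) (s : S) (σ : StagePolicy M N),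
    objective M N k σ Γ s ≤ objective M N k (block N π k) Γ s

/-- The expected total incentive paid by the principal under the agent policy `π`. -/
noncomputable def cost (M : MDP S A AP) (Γ : Incentive S A) (π : Policy M) : ℝ≥0∞ :=
  ∫⁻ ω, ∑' t, (Γ t (ω t).1 (ω t).2 : ℝ≥0∞) ∂(pathMeasure π M.init)

/-- The constraints of the design problem: `π` is an optimal response of the agent to `Γ`, and
it satisfies `φ` with the maximum probability among all policies. -/
def Feasible (M : MDP S A AP) (N : ℕ) [NeZero N] (φ : SCLTL AP) (Γ : Incentive S A)
    (π : Policy M) : Prop :=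
  AgentOptimal M N Γ π ∧ ∀ σ : Policy M, satProb M φ σ ≤ satProb M φ π

/-- The optimal value of the design problem. -/
noncomputable def optimalCost (M : MDP S A AP) (N : ℕ) [NeZero N] (φ : SCLTL AP) : ℝ≥0∞ :=
  ⨅ (Γ : Incentive S A) (π : Policy M) (_ : Feasible M N φ Γ π), cost M Γ π

/-- `Γ` is an `ε`-optimal incentive design: the agent has an optimal response to `Γ`, and every
optimal response satisfies `φ` with maximum probability, at a finite cost that exceeds the
optimal value by at most `ε`. -/
structure IsEpsOptimal (M : MDP S A AP) (N : ℕ) [NeZero N] (φ : SCLTL AP) (ε : ℝ≥0)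
    (Γ : Incentive S A) : Prop where
  exists_response : ∃ π : Policy M, AgentOptimal M N Γ π
  feasible : ∀ π : Policy M, AgentOptimal M N Γ π → Feasible M N φ Γ π
  cost_lt_top : ∀ π : Policy M, AgentOptimal M N Γ π → cost M Γ π < ∞
  cost_le : ∀ π : Policy M, AgentOptimal M N Γ π → cost M Γ π ≤ optimalCost M N φ + ε

end IncentiveDesign

/-! Let `W` be the value of the `N`-stage problem without incentives. An available action at stage
`t` loses `W t s - R s a - W (t+1) (f s a) ≥ 0`. Paying exactly this loss (`compensation`) makes the
agent indifferent: block totals telescope to `W 0 s` under every policy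
(`total_payoff_compensation`).

Compensation is a lower bound on cost. Since incentives are nonnegative, an optimal response earns
at least `W 0 s` per block, so the expected payment in that block is at least its expected loss;
summing over blocks gives `AgentOptimal.cost_compensation_le`.

Determinism makes the maximal satisfaction probability 0 or 1: a satisfying path can be followed
surely. If none exists, paying nothing works. Otherwise feasible policies satisfy the formula almost
surely, and some satisfying path has total compensation at most the mean
(`exists_path_tsum_le_cost`), hence close to the optimal cost.

Such a path is enforced by paying compensation plus a bonus `δ > 0` on it, and nothing off it, over
finitely many whole blocks covering a good prefix (`SCLTL.Sat.exists_prefix`). The gain over `W 0 s`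
is at most `δ` times the expected number of stages on the path, so every optimal response starting
on the path stays on it (`AgentOptimal.pairLaw_eq`). The bonuses cost an arbitrarily small amount.
-/

namespace IncentiveDesign

/-! ### Marginal distributions of the path measure -/

section Marginals

variable {S A AP : Type*} [Fintype S] [Fintype A] {M : MDP S A AP}

/-- The distribution of the state at index `n` under the policy `π` from the state `s`. -/
noncomputable def stateLaw (π : Policy M) (s : S) : ℕ → PMF S
  | 0 => PMF.pure s
  | n + 1 => ((stateLaw π s n).bind (π n).stateAction).bind fun x => M.next x.1 x.2

/-- The distribution of the state-action pair at index `n` under `π` from `s`. -/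
noncomputable def pairLaw (π : Policy M) (s : S) (n : ℕ) : PMF (S × A) :=
  (stateLaw π s n).bind (π n).stateAction

theorem stateLaw_succ (π : Policy M) (s : S) (n : ℕ) :
    stateLaw π s (n + 1) = (pairLaw π s n).bind fun x => M.next x.1 x.2 := rfl

theorem pairLaw_zero (π : Policy M) (s : S) : pairLaw π s 0 = (π 0).stateAction s := by
  simp [pairLaw, stateLaw]

theorem pairLaw_succ (π : Policy M) (s : S) (n : ℕ) :
    pairLaw π s (n + 1) = (pairLaw π s n).bind (stepPMF (π (n + 1))) := by
  rw [pairLaw, stateLaw_succ, PMF.bind_bind]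
  rfl

theorem stateLaw_congr {π σ : Policy M} {n : ℕ} (h : ∀ t < n, π t = σ t) (s : S) :
    stateLaw π s n = stateLaw σ s n := by
  induction n with
  | zero => rfl
  | succ n ih =>
    rw [stateLaw, stateLaw, ih fun t ht => h t (ht.trans n.lt_succ_self), h n n.lt_succ_self]

theorem pairLaw_congr {π σ : Policy M} {n : ℕ} (h : ∀ t ≤ n, π t = σ t) (s : S) :
    pairLaw π s n = pairLaw σ s n := by
  rw [pairLaw, pairLaw, stateLaw_congr fun t ht => h t ht.le, h n le_rfl]

/-- Markov property at time `m`; it lets the agent's blocks be studied separately, each from its own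
starting state. -/
theorem stateLaw_add (π : Policy M) (s : S) (m n : ℕ) :
    stateLaw π s (m + n) =
      (stateLaw π s m).bind fun s' => stateLaw (fun t => π (m + t)) s' n := by
  induction n with
  | zero => simp [stateLaw]
  | succ n ih =>
    rw [← add_assoc, stateLaw, ih]
    simp only [PMF.bind_bind, stateLaw]

theorem pairLaw_add (π : Policy M) (s : S) (m n : ℕ) :
    pairLaw π s (m + n) =
      (stateLaw π s m).bind fun s' => pairLaw (fun t => π (m + t)) s' n := by
  simp only [pairLaw, stateLaw_add, PMF.bind_bind]

theorem stateAction_apply_ne_zero {d : DecisionRule M} {s : S} {x : S × A}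
    (h : d.stateAction s x ≠ 0) : x.1 = s ∧ x.2 ∈ M.avail s := by
  have hx : x ∈ (d.stateAction s).support := h
  rw [DecisionRule.stateAction, PMF.mem_support_map_iff] at hx
  obtain ⟨a, ha, rfl⟩ := hx
  refine ⟨rfl, ?_⟩
  by_contra hna
  apply ha
  simp [DecisionRule.action, d.eq_zero s a hna]

theorem pairLaw_apply_ne_zero {π : Policy M} {s : S} {n : ℕ} {x : S × A}
    (h : pairLaw π s n x ≠ 0) : x.2 ∈ M.avail x.1 := by
  have hx : x ∈ (pairLaw π s n).support := h
  rw [pairLaw, PMF.mem_support_bind_iff] at hx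
  obtain ⟨s', -, hs'⟩ := hx
  obtain ⟨h1, h2⟩ := stateAction_apply_ne_zero hs'
  rwa [h1]

theorem pairLaw_map_fst (π : Policy M) (s : S) (n : ℕ) :
    (pairLaw π s n).map Prod.fst = stateLaw π s n := by
  simp only [pairLaw, PMF.map_bind, DecisionRule.stateAction, PMF.map_comp]
  have : (fun s' : S => PMF.map (Prod.fst ∘ fun a => (s', a)) ((π n).action s')) = PMF.pure := by
    funext s'
    exact PMF.map_const _ _
  rw [this, PMF.bind_pure]

end Marginals

/-! ### Identification of the marginals of the path measure -/

section PathLaw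

variable {S A AP : Type*} [Fintype S] [Fintype A] {M : MDP S A AP}
  [MeasurableSpace S] [DiscreteMeasurableSpace S]
  [MeasurableSpace A] [DiscreteMeasurableSpace A]

instance (π : Policy M) (s : S) : IsProbabilityMeasure (pathMeasure π s) := by
  have := PMF.toMeasure.isProbabilityMeasure ((π 0).stateAction s)
  rw [pathMeasure]
  infer_instance

theorem map_zero_pathMeasure (π : Policy M) (s : S) :
    (pathMeasure π s).map (fun ω => ω 0) = ((π 0).stateAction s).toMeasure := by
  have := PMF.toMeasure.isProbabilityMeasure ((π 0).stateAction s)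
  have hf : (fun ω : ℕ → S × A => ω 0) =
      (fun h : ∀ _ : Finset.Iic 0, S × A => h ⟨0, Finset.mem_Iic.2 le_rfl⟩) ∘
        Preorder.frestrictLe 0 := rfl
  rw [hf, ← Measure.map_map (by fun_prop) (by fun_prop), pathMeasure, Kernel.trajMeasure,
    Measure.map_comp _ _ (by fun_prop), Kernel.traj_map_frestrictLe, Kernel.partialTraj_self,
    Measure.id_comp, Measure.map_map (by fun_prop) (by fun_prop)]
  convert Measure.map_id
  funext x
  rfl

/-- The history up to `n` together with the next pair has law history ⊗ kernel, and the kernel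
depends only on the last pair of the history. -/
theorem lintegral_pathMeasure_pair (π : Policy M) (s : S) (n : ℕ) (F : S × A → S × A → ℝ≥0∞) :
    ∫⁻ ω, F (ω n) (ω (n + 1)) ∂(pathMeasure π s) =
      ∫⁻ ω, ∫⁻ y, F (ω n) y ∂(stepPMF (π (n + 1)) (ω n)).toMeasure ∂(pathMeasure π s) := by
  have := PMF.toMeasure.isProbabilityMeasure ((π 0).stateAction s)
  have hF : Measurable (fun p : (∀ _ : Finset.Iic n, S × A) × (S × A) =>
      F (p.1 ⟨n, Finset.mem_Iic.2 le_rfl⟩) p.2) := by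
    have : Measurable (Function.uncurry F) := .of_discrete
    exact this.comp (by fun_prop : Measurable fun p : (∀ _ : Finset.Iic n, S × A) × (S × A) =>
      (p.1 ⟨n, Finset.mem_Iic.2 le_rfl⟩, p.2))
  have key := Kernel.map_frestrictLe_trajMeasure_compProd_eq_map_trajMeasure
    (X := fun _ => S × A) (μ₀ := ((π 0).stateAction s).toMeasure) (κ := stepKernel π) (a := n)
  have h2 := congrArg (fun μ => ∫⁻ p, F (p.1 ⟨n, Finset.mem_Iic.2 le_rfl⟩) p.2 ∂μ) key
  rw [lintegral_map hF (by fun_prop), Measure.lintegral_compProd hF,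
    lintegral_map (hF.lintegral_kernel_prod_right') (by fun_prop)] at h2
  exact h2.symm

theorem map_pathMeasure (π : Policy M) (s : S) (n : ℕ) :
    (pathMeasure π s).map (fun ω => ω n) = (pairLaw π s n).toMeasure := by
  induction n with
  | zero => rw [map_zero_pathMeasure, pairLaw_zero]
  | succ n ih =>
    ext B hB
    rw [pairLaw_succ, PMF.toMeasure_bind_apply _ _ _ hB, Measure.map_apply (by fun_prop) hB,
      ← lintegral_indicator_one ((measurable_pi_apply (n + 1)) hB)]
    have h := lintegral_pathMeasure_pair π s n (fun _ y => B.indicator 1 y)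
    have h3 : ∀ x : S × A, ∫⁻ y, B.indicator 1 y ∂(stepPMF (π (n + 1)) x).toMeasure =
        (stepPMF (π (n + 1)) x).toMeasure B := fun x => lintegral_indicator_one hB
    simp only [h3] at h
    refine Eq.trans ?_ (h.trans ?_)
    · rfl
    · have hm : Measurable fun x : S × A => (stepPMF (π (n + 1)) x).toMeasure B := .of_discrete
      rw [← lintegral_map (f := fun x : S × A => (stepPMF (π (n + 1)) x).toMeasure B)
        (g := fun ω : ℕ → S × A => ω n) hm (by fun_prop), ih, lintegral_fintype, tsum_fintype]
      refine Finset.sum_congr rfl fun x _ => ?_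
      rw [PMF.toMeasure_apply_singleton _ _ (.singleton x), mul_comm]

theorem ae_pathMeasure_of_pairLaw {π : Policy M} {s : S} {n : ℕ} {p : S × A → Prop}
    (h : ∀ x, pairLaw π s n x ≠ 0 → p x) : ∀ᵐ ω ∂(pathMeasure π s), p (ω n) := by
  have h1 : ∀ᵐ x ∂((pathMeasure π s).map fun ω => ω n), p x := by
    rw [map_pathMeasure, ae_iff, PMF.toMeasure_apply_eq_zero_iff _ .of_discrete]
    exact Set.disjoint_left.2 fun x hx hnp => hnp (h x hx)
  exact ae_of_ae_map (measurable_pi_apply n).aemeasurable h1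

/-- The indicator of the null transitions has zero conditional mean. This turns statements about
laws into statements about individual paths. -/
theorem ae_stepPMF_ne_zero (π : Policy M) (s : S) (n : ℕ) :
    ∀ᵐ ω ∂(pathMeasure π s), stepPMF (π (n + 1)) (ω n) (ω (n + 1)) ≠ 0 := by
  classical
  have h := lintegral_pathMeasure_pair π s n
    (fun x y => if stepPMF (π (n + 1)) x y = 0 then 1 else 0)
  have h0 : ∀ x : S × A, ∫⁻ y, (if stepPMF (π (n + 1)) x y = 0 then (1 : ℝ≥0∞) else 0)
      ∂(stepPMF (π (n + 1)) x).toMeasure = 0 := by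
    intro x
    rw [lintegral_fintype]
    refine Finset.sum_eq_zero fun y _ => ?_
    rw [PMF.toMeasure_apply_singleton _ _ (.singleton y)]
    split_ifs with hy <;> simp [hy]
  simp only [h0, lintegral_zero] at h
  have hm : Measurable (Function.uncurry fun x y : S × A =>
      if stepPMF (π (n + 1)) x y = 0 then (1 : ℝ≥0∞) else 0) := .of_discrete
  have hm' := hm.comp (by fun_prop : Measurable fun ω : ℕ → S × A => (ω n, ω (n + 1)))
  have h2 := (lintegral_eq_zero_iff hm').1 h
  filter_upwards [h2] with ω hω h3
  simp [h3] at hω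

end PathLaw

end IncentiveDesign
namespace IncentiveDesign

/-! ### Means with respect to a probability mass function -/

theorem eq_pure_of_one_le_toReal {α : Type*} {p : PMF α} {a : α} (h : 1 ≤ (p a).toReal) : p = PMF.pure a := by
  have h1 : p a = 1 := by
    refine le_antisymm (p.coe_le_one a) ?_
    rw [← ENNReal.ofReal_one]
    exact (ENNReal.ofReal_le_iff_le_toReal (p.apply_ne_top a)).2 h
  have hs := (p.apply_eq_one_iff a).1 h1
  ext b
  by_cases hb : b = a
  · subst hb
    simp [h1]
  · have : b ∉ p.support := by simp [hs, hb]
    rw [PMF.apply_eq_zero_iff _ _ |>.2 this]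
    simp [PMF.pure_apply, hb]

section Mean

variable {α β : Type*} [Fintype α] [Fintype β]

/-- The mean of a real function on a finite type. -/
noncomputable def mean (p : PMF α) (g : α → ℝ) : ℝ := ∑ x, (p x).toReal * g x

theorem mean_pure (a : α) (g : α → ℝ) : mean (PMF.pure a) g = g a := by
  classical
  rw [mean, Finset.sum_eq_single a]
  · simp
  · intro b _ hb
    simp [PMF.pure_apply, hb]
  · simp

theorem mean_bind (p : PMF α) (q : α → PMF β) (g : β → ℝ) :
    mean (p.bind q) g = mean p fun x => mean (q x) g := by
  have h : ∀ y, ((p.bind q) y).toReal = ∑ x, (p x).toReal * (q x y).toReal := by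
    intro y
    rw [PMF.bind_apply, tsum_fintype, ENNReal.toReal_sum]
    · simp
    · exact fun x _ => ENNReal.mul_ne_top (p.apply_ne_top x) ((q x).apply_ne_top y)
  simp only [mean, h, Finset.sum_mul, Finset.mul_sum]
  rw [Finset.sum_comm]
  simp only [mul_assoc]

theorem mean_add (p : PMF α) (g h : α → ℝ) :
    mean p (fun x => g x + h x) = mean p g + mean p h := by
  simp [mean, mul_add, Finset.sum_add_distrib]

theorem mean_sub (p : PMF α) (g h : α → ℝ) :
    mean p (fun x => g x - h x) = mean p g - mean p h := by
  simp [mean, mul_sub, Finset.sum_sub_distrib]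

theorem mean_finsetSum {ι : Type*} (s : Finset ι) (p : PMF α) (g : ι → α → ℝ) :
    mean p (fun x => ∑ i ∈ s, g i x) = ∑ i ∈ s, mean p (g i) := by
  simp only [mean, Finset.mul_sum]
  exact Finset.sum_comm

theorem mean_mono {p : PMF α} {g h : α → ℝ} (H : ∀ x, p x ≠ 0 → g x ≤ h x) :
    mean p g ≤ mean p h := by
  refine Finset.sum_le_sum fun x _ => ?_
  by_cases hx : p x = 0
  · simp [hx]
  · exact mul_le_mul_of_nonneg_left (H x hx) ENNReal.toReal_nonneg

theorem mean_congr {p : PMF α} {g h : α → ℝ} (H : ∀ x, p x ≠ 0 → g x = h x) :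
    mean p g = mean p h :=
  (mean_mono fun x hx => (H x hx).le).antisymm (mean_mono fun x hx => (H x hx).ge)

theorem integral_toMeasure [MeasurableSpace α] [DiscreteMeasurableSpace α]
    (p : PMF α) (g : α → ℝ) : ∫ x, g x ∂p.toMeasure = mean p g := by
  rw [PMF.integral_eq_sum]
  rfl

theorem lintegral_toMeasure [MeasurableSpace α] [DiscreteMeasurableSpace α]
    (p : PMF α) (g : α → ℝ≥0) :
    ∫⁻ x, (g x : ℝ≥0∞) ∂p.toMeasure = ENNReal.ofReal (mean p fun x => (g x : ℝ)) := by
  have := PMF.toMeasure.isProbabilityMeasure p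
  rw [← integral_toMeasure, ofReal_integral_eq_lintegral_ofReal .of_finite
    (Filter.Eventually.of_forall fun x => NNReal.coe_nonneg (g x))]
  simp

end Mean

/-! ### Finite-horizon dynamic programming for deterministic transitions -/

theorem exists_next_eq_pure {S A AP : Type*} [Fintype S] (M : MDP S A AP)
    (hdet : ∀ s, ∀ a ∈ M.avail s, ∀ s', M.trans s a s' = 0 ∨ M.trans s a s' = 1) :
    ∃ f : S → A → S, ∀ s a, M.next s a = PMF.pure (f s a) := by
  have h : ∀ s a, ∃ s', M.next s a = PMF.pure s' := by
    intro s a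
    by_cases ha : a ∈ M.avail s
    · have hne : ∃ s', M.trans s a s' ≠ 0 := by
        by_contra! h0
        have := M.trans_sum s a ha
        simp [h0] at this
      obtain ⟨s', hs'⟩ := hne
      refine ⟨s', eq_pure_of_one_le_toReal ?_⟩
      have h1 := (hdet s a ha s').resolve_left hs'
      simp [MDP.next, ha, h1]
    -- Unavailable actions stay in `s` by the default in `MDP.next`, so `f` is total.
    · exact ⟨s, by simp [MDP.next, ha]⟩
  choose f hf using h
  exact ⟨f, hf⟩

section

variable {S A AP : Type*} [Fintype S] {M : MDP S A AP} {f : S → A → S}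

/-- The loss of value when `a` is taken in `s` at stage `t`, for stage payoffs `ρ` and values
`V`. -/
def loss (f : S → A → S) (ρ : ℕ → S → A → ℝ) (V : ℕ → S → ℝ) (t : ℕ) (s : S) (a : A) : ℝ :=
  V t s - ρ t s a - V (t + 1) (f s a)

/-- `V` solves the optimality equation of the `N`-stage problem with stage payoffs `ρ`. -/
structure IsValue (M : MDP S A AP) (f : S → A → S) (N : ℕ) (ρ : ℕ → S → A → ℝ)
    (V : ℕ → S → ℝ) : Prop where
  terminal : ∀ s, V N s = 0
  loss_nonneg : ∀ t < N, ∀ s, ∀ a ∈ M.avail s, 0 ≤ loss f ρ V t s a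
  exists_loss_eq_zero : ∀ t < N, ∀ s, ∃ a ∈ M.avail s, loss f ρ V t s a = 0

/-- Backward induction: the tail problem with shifted payoffs is solved, then the maximum over first
actions is prepended as stage 0. -/
theorem exists_isValue (M : MDP S A AP) (f : S → A → S) (N : ℕ) (ρ : ℕ → S → A → ℝ) :
    ∃ V, IsValue M f N ρ V := by
  induction N generalizing ρ with
  | zero => exact ⟨fun _ _ => 0, fun _ => rfl, by simp, by simp⟩
  | succ N ih =>
    obtain ⟨V, hV⟩ := ih fun t => ρ (t + 1)
    refine ⟨fun t => Nat.casesOn t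
      (fun s => (M.avail s).sup' (M.avail_nonempty s) fun a => ρ 0 s a + V 0 (f s a)) V,
      hV.terminal, ?_, ?_⟩
    · rintro (_ | t) ht s a ha
      · have := Finset.le_sup' (fun a => ρ 0 s a + V 0 (f s a)) ha
        change 0 ≤ (M.avail s).sup' _ (fun a => ρ 0 s a + V 0 (f s a)) - ρ 0 s a - V 0 (f s a)
        linarith
      · exact hV.loss_nonneg t (by omega) s a ha
    · rintro (_ | t) ht s
      · obtain ⟨a, ha, h⟩ := Finset.exists_mem_eq_sup' (M.avail_nonempty s)
          fun a => ρ 0 s a + V 0 (f s a)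
        refine ⟨a, ha, ?_⟩
        change (M.avail s).sup' _ (fun a => ρ 0 s a + V 0 (f s a)) - ρ 0 s a - V 0 (f s a) = 0
        rw [h]
        ring
      · exact hV.exists_loss_eq_zero t (by omega) s

end

section DynamicProgramming

variable {S A AP : Type*} [Fintype S] [Fintype A] {M : MDP S A AP} {f : S → A → S}

open Classical in
/-- The decision rule choosing the action `g s` in the state `s`. -/
noncomputable def DecisionRule.dirac {g : S → A} (hg : ∀ s, g s ∈ M.avail s) :
    DecisionRule M where
  prob s a := if a = g s then 1 else 0
  nonneg s a := by split_ifs <;> norm_num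
  eq_zero s a ha := if_neg fun h : a = g s => ha (h ▸ hg s)
  sum_avail s := by simp [hg s]

theorem DecisionRule.stateAction_dirac {g : S → A} (hg : ∀ s, g s ∈ M.avail s) (s : S) :
    (DecisionRule.dirac hg).stateAction s = PMF.pure (s, g s) := by
  have : (DecisionRule.dirac hg).action s = PMF.pure (g s) := by
    apply eq_pure_of_one_le_toReal
    simp [DecisionRule.action, DecisionRule.dirac]
  rw [DecisionRule.stateAction, this, PMF.pure_map]

theorem mean_pairLaw_fst (π : Policy M) (s : S) (n : ℕ) (V : S → ℝ) :
    mean (pairLaw π s n) (fun x => V x.1) = mean (stateLaw π s n) V := by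
  rw [← pairLaw_map_fst, PMF.map, mean_bind]
  simp [mean_pure]

theorem mean_pairLaw_succ (hf : ∀ s a, M.next s a = PMF.pure (f s a)) (π : Policy M) (s : S)
    (n : ℕ) (V : S → ℝ) :
    mean (pairLaw π s n) (fun x => V (f x.1 x.2)) = mean (stateLaw π s (n + 1)) V := by
  simp [stateLaw_succ, mean_bind, hf, mean_pure]

/-- The expected total of the stage payoffs `ρ` over `N` stages. -/
noncomputable def total (ρ : ℕ → S → A → ℝ) (N : ℕ) (π : Policy M) (s : S) : ℝ :=
  ∑ t ∈ Finset.range N, mean (pairLaw π s t) fun x => ρ t x.1 x.2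

theorem total_congr {ρ : ℕ → S → A → ℝ} {N : ℕ} {π σ : Policy M} (h : ∀ t < N, π t = σ t)
    (s : S) : total ρ N π s = total ρ N σ s := by
  refine Finset.sum_congr rfl fun t ht => ?_
  rw [pairLaw_congr fun i hi => h i (hi.trans_lt (Finset.mem_range.1 ht))]

theorem total_mono {ρ ρ' : ℕ → S → A → ℝ} {N : ℕ} (π : Policy M) (s : S)
    (h : ∀ t < N, ∀ s, ∀ a ∈ M.avail s, ρ t s a ≤ ρ' t s a) :
    total ρ N π s ≤ total ρ' N π s :=
  Finset.sum_le_sum fun t ht => mean_mono fun x hx =>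
    h t (Finset.mem_range.1 ht) x.1 x.2 (pairLaw_apply_ne_zero hx)

theorem total_add (ρ ρ' : ℕ → S → A → ℝ) (N : ℕ) (π : Policy M) (s : S) :
    total (fun t s a => ρ t s a + ρ' t s a) N π s = total ρ N π s + total ρ' N π s := by
  simp [total, mean_add, Finset.sum_add_distrib]

/-- Payoff plus loss is `V t s - V (t+1) (f s a)`, so expectations telescope whatever the policy;
only the terminal condition on `V` matters. -/
theorem total_add_loss (hf : ∀ s a, M.next s a = PMF.pure (f s a)) (ρ : ℕ → S → A → ℝ)
    {N : ℕ} {V : ℕ → S → ℝ} (hV : ∀ s, V N s = 0) (π : Policy M) (s : S) :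
    total (fun t s a => ρ t s a + loss f ρ V t s a) N π s = V 0 s := by
  have h : ∀ t, mean (pairLaw π s t) (fun x => ρ t x.1 x.2 + loss f ρ V t x.1 x.2) =
      mean (stateLaw π s t) (V t) - mean (stateLaw π s (t + 1)) (V (t + 1)) := by
    intro t
    rw [← mean_pairLaw_fst, ← mean_pairLaw_succ hf, ← mean_sub]
    refine mean_congr fun x _ => ?_
    rw [loss]
    ring
  rw [total, Finset.sum_congr rfl fun t _ => h t, Finset.sum_range_sub', stateLaw, mean_pure]
  simp [mean, hV]

theorem IsValue.total_le (hf : ∀ s a, M.next s a = PMF.pure (f s a)) {N : ℕ}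
    {ρ : ℕ → S → A → ℝ} {V : ℕ → S → ℝ} (hV : IsValue M f N ρ V) (π : Policy M) (s : S) :
    total ρ N π s ≤ V 0 s := by
  rw [← total_add_loss hf ρ hV.terminal π s]
  refine total_mono π s fun t ht s a ha => ?_
  linarith [hV.loss_nonneg t ht s a ha]

theorem IsValue.exists_total_eq (hf : ∀ s a, M.next s a = PMF.pure (f s a)) {N : ℕ}
    {ρ : ℕ → S → A → ℝ} {V : ℕ → S → ℝ} (hV : IsValue M f N ρ V) :
    ∃ π : Policy M, ∀ s, total ρ N π s = V 0 s := by
  -- Greedy actions have zero loss; from stage `N` on any available action completes the policy.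
  have h : ∀ t s, ∃ a ∈ M.avail s, t < N → loss f ρ V t s a = 0 := by
    intro t s
    by_cases ht : t < N
    · obtain ⟨a, ha, h⟩ := hV.exists_loss_eq_zero t ht s
      exact ⟨a, ha, fun _ => h⟩
    · obtain ⟨a, ha⟩ := M.avail_nonempty s
      exact ⟨a, ha, fun h => absurd h ht⟩
  choose g hg h0 using h
  refine ⟨fun t => .dirac (hg t), fun s => ?_⟩
  rw [← total_add_loss hf ρ hV.terminal (fun t => .dirac (hg t)) s]
  refine Finset.sum_congr rfl fun t ht => ?_
  simp only [pairLaw, mean_bind, DecisionRule.stateAction_dirac, mean_pure,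
    h0 t _ (Finset.mem_range.1 ht), add_zero]

end DynamicProgramming

/-! ### Paths of a deterministic decision process -/

section

variable {S A AP : Type*} [Fintype S] {M : MDP S A AP} {f : S → A → S}

/-- `w` is an infinite path of state-action pairs for the transition function `f`. -/
structure IsPath (M : MDP S A AP) (f : S → A → S) (w : ℕ → S × A) : Prop where
  mem_avail : ∀ n, (w n).2 ∈ M.avail (w n).1
  succ : ∀ n, (w (n + 1)).1 = f (w n).1 (w n).2

theorem IsPath.shift {w : ℕ → S × A} (hw : IsPath M f w) (m : ℕ) :
    IsPath M f fun n => w (m + n) :=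
  ⟨fun _ => hw.mem_avail _, fun _ => hw.succ _⟩

/-- The agent's payoff at stage `t` of the `k`-th block. -/
def payoff (M : MDP S A AP) (N : ℕ) (Γ : Incentive S A) (k t : ℕ) (s : S) (a : A) : ℝ :=
  M.reward s a + (Γ (k * N + t) s a : ℝ)

/-- The incentive design that compensates exactly for the loss of value, for the values `W` of
the problem without incentives. -/
noncomputable def compensation (M : MDP S A AP) (f : S → A → S) (W : ℕ → S → ℝ) (N : ℕ) :
    Incentive S A :=
  fun n s a => (loss f (fun _ => M.reward) W (n % N) s a).toNNReal

theorem compensation_add {W : ℕ → S → ℝ} {N : ℕ} (hW : IsValue M f N (fun _ => M.reward) W)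
    (k : ℕ) {t : ℕ} (ht : t < N) {s : S} {a : A} (ha : a ∈ M.avail s) :
    (compensation M f W N (k * N + t) s a : ℝ) = loss f (fun _ => M.reward) W t s a := by
  rw [compensation, mul_comm, Nat.mul_add_mod, Nat.mod_eq_of_lt ht,
    Real.coe_toNNReal _ (hW.loss_nonneg t ht s a ha)]

end

section Paths

variable {S A AP : Type*} [Fintype S] [Fintype A] {M : MDP S A AP} {f : S → A → S}

/-- The rule at time `n` plays the path's action in the path's state and anything available
elsewhere. Rules depend on time because a path may revisit a state with another action. -/
theorem IsPath.exists_policy (hf : ∀ s a, M.next s a = PMF.pure (f s a)) {w : ℕ → S × A}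
    (hw : IsPath M f w) :
    ∃ π : Policy M, ∀ n, pairLaw π (w 0).1 n = PMF.pure (w n) := by
  have h : ∀ n s, ∃ a ∈ M.avail s, s = (w n).1 → a = (w n).2 := by
    intro n s
    by_cases hs : s = (w n).1
    · exact ⟨(w n).2, hs ▸ hw.mem_avail n, fun _ => rfl⟩
    · obtain ⟨a, ha⟩ := M.avail_nonempty s
      exact ⟨a, ha, fun h => absurd h hs⟩
  choose g hg h0 using h
  refine ⟨fun n => .dirac (hg n), fun n => ?_⟩
  have hstep : ∀ n, (DecisionRule.dirac (hg n)).stateAction (w n).1 = PMF.pure (w n) := by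
    intro n
    rw [DecisionRule.stateAction_dirac, h0 n _ rfl]
  induction n with
  | zero => rw [pairLaw_zero, hstep]
  | succ n ih => rw [pairLaw_succ, ih, PMF.pure_bind, stepPMF, hf, PMF.pure_bind, ← hw.succ, hstep]

theorem total_payoff_compensation (hf : ∀ s a, M.next s a = PMF.pure (f s a)) {W : ℕ → S → ℝ}
    {N : ℕ} (hW : IsValue M f N (fun _ => M.reward) W) (k : ℕ) (π : Policy M) (s : S) :
    total (payoff M N (compensation M f W N) k) N π s = W 0 s := by
  rw [← total_add_loss hf (fun _ => M.reward) hW.terminal π s]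
  have h : ∀ t < N, ∀ s, ∀ a ∈ M.avail s, payoff M N (compensation M f W N) k t s a =
      M.reward s a + loss f (fun _ => M.reward) W t s a := fun t ht s a ha => by
    rw [payoff, compensation_add hW k ht ha]
  exact (total_mono π s fun t ht s a ha => (h t ht s a ha).le).antisymm
    (total_mono π s fun t ht s a ha => (h t ht s a ha).ge)

variable [MeasurableSpace S] [DiscreteMeasurableSpace S]
  [MeasurableSpace A] [DiscreteMeasurableSpace A]

theorem ae_isPath (hf : ∀ s a, M.next s a = PMF.pure (f s a)) (π : Policy M) (s : S) :
    ∀ᵐ ω ∂(pathMeasure π s), (ω 0).1 = s ∧ IsPath M f ω := by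
  have h0 : ∀ᵐ ω ∂(pathMeasure π s), (ω 0).1 = s :=
    ae_pathMeasure_of_pairLaw (p := fun x => x.1 = s) fun x hx => by
      rw [pairLaw_zero] at hx
      exact (stateAction_apply_ne_zero hx).1
  have h1 : ∀ᵐ ω ∂(pathMeasure π s), ∀ n, (ω n).2 ∈ M.avail (ω n).1 :=
    ae_all_iff.2 fun n => ae_pathMeasure_of_pairLaw (p := fun x => x.2 ∈ M.avail x.1)
      fun x hx => pairLaw_apply_ne_zero hx
  filter_upwards [h0, h1, ae_all_iff.2 (ae_stepPMF_ne_zero π s)] with ω h0 h1 h2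
  refine ⟨h0, h1, fun n => ?_⟩
  have := h2 n
  rw [stepPMF, hf, PMF.pure_bind] at this
  exact (stateAction_apply_ne_zero this).1

theorem ae_eq_of_pairLaw_eq_pure {π : Policy M} {s : S} {n : ℕ} {x : S × A}
    (h : pairLaw π s n = PMF.pure x) : ∀ᵐ ω ∂(pathMeasure π s), ω n = x := by
  refine ae_pathMeasure_of_pairLaw (p := fun y => y = x) fun y hy => ?_
  rw [h] at hy
  have hy' : y ∈ (PMF.pure x).support := hy
  simpa using hy'

end Paths

/-! ### Objective, cost and satisfaction probability -/

section Design

variable {S A AP : Type*} [Fintype S] [Fintype A] {M : MDP S A AP} {f : S → A → S}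
  [MeasurableSpace S] [DiscreteMeasurableSpace S]
  [MeasurableSpace A] [DiscreteMeasurableSpace A]

/-- The periodic extension through `Fin.ofNat` is harmless: `total` sees only the first `N` rules.
-/
theorem objective_eq_total (N : ℕ) [NeZero N] (k : ℕ) (σ : StagePolicy M N)
    (Γ : Incentive S A) (s : S) {π : Policy M} (h : ∀ t < N, σ (Fin.ofNat N t) = π t) :
    objective M N k σ Γ s = total (payoff M N Γ k) N π s := by
  rw [← total_congr (π := fun t => σ (Fin.ofNat N t)) h, objective, total, integral_finsetSum]
  · refine Finset.sum_congr rfl fun t _ => ?_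
    rw [← integral_toMeasure, ← map_pathMeasure,
      integral_map (measurable_pi_apply t).aemeasurable
        (Measurable.of_discrete.aestronglyMeasurable)]
    rfl
  · intro t _
    have h1 : Integrable (fun x : S × A => M.reward x.1 x.2 + (Γ (k * N + t) x.1 x.2 : ℝ))
        ((pathMeasure (fun t => σ (Fin.ofNat N t)) s).map fun ω => ω t) := by
      have := Measure.isProbabilityMeasure_map
        (μ := pathMeasure (fun t => σ (Fin.ofNat N t)) s) (measurable_pi_apply t).aemeasurable
      exact .of_finite
    exact h1.comp_measurable (measurable_pi_apply t)

theorem objective_policy (N : ℕ) [NeZero N] (k : ℕ) (Γ : Incentive S A) (s : S) (π : Policy M) :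
    objective M N k (fun t => π t) Γ s = total (payoff M N Γ k) N π s :=
  objective_eq_total N k _ Γ s fun t ht => by simp [Nat.mod_eq_of_lt ht]

theorem objective_block (N : ℕ) [NeZero N] (k : ℕ) (Γ : Incentive S A) (s : S) (π : Policy M) :
    objective M N k (block N π k) Γ s =
      total (payoff M N Γ k) N (fun t => π (k * N + t)) s :=
  objective_eq_total N k _ Γ s fun t ht => by simp [block, Nat.mod_eq_of_lt ht]

theorem AgentOptimal.total_le {N : ℕ} [NeZero N] {Γ : Incentive S A} {π : Policy M}
    (h : AgentOptimal M N Γ π) (k : ℕ) (s : S) (σ : Policy M) :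
    total (payoff M N Γ k) N σ s ≤ total (payoff M N Γ k) N (fun t => π (k * N + t)) s := by
  rw [← objective_policy, ← objective_block]
  exact h k s _

/-- The agent's blocks do not interact, so greedy policies for the individual blocks can be
concatenated. -/
theorem exists_agentOptimal (hf : ∀ s a, M.next s a = PMF.pure (f s a)) (N : ℕ) [NeZero N]
    (Γ : Incentive S A) : ∃ π : Policy M, AgentOptimal M N Γ π := by
  choose V hV using fun k => exists_isValue M f N (payoff M N Γ k)
  choose g hg using fun k => (hV k).exists_total_eq hf
  refine ⟨fun n => g (n / N) (n % N), fun k s σ => ?_⟩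
  rw [objective_eq_total N k σ Γ s (π := fun t => σ (Fin.ofNat N t)) fun t _ => rfl,
    objective_block]
  refine ((hV k).total_le hf _ s).trans ?_
  rw [← hg k s]
  refine (total_congr (fun t ht => ?_) s).le
  have h1 : (k * N + t) / N = k := by
    rw [mul_comm, Nat.mul_add_div (Nat.pos_of_neZero N), Nat.div_eq_of_lt ht, add_zero]
  have h2 : (k * N + t) % N = t := by
    rw [mul_comm, Nat.mul_add_mod, Nat.mod_eq_of_lt ht]
  rw [h1, h2]

theorem cost_eq_tsum (Γ : Incentive S A) (π : Policy M) :
    cost M Γ π =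
      ∑' n, ENNReal.ofReal (mean (pairLaw π M.init n) fun x => (Γ n x.1 x.2 : ℝ)) := by
  have hm : ∀ n, Measurable fun x : S × A => (Γ n x.1 x.2 : ℝ≥0∞) := fun n => .of_discrete
  have hc : ∀ n, AEMeasurable (fun ω : ℕ → S × A => (Γ n (ω n).1 (ω n).2 : ℝ≥0∞))
      (pathMeasure π M.init) := fun n => ((hm n).comp (measurable_pi_apply n)).aemeasurable
  rw [cost, lintegral_tsum hc]
  refine tsum_congr fun n => ?_
  rw [← lintegral_toMeasure, ← map_pathMeasure, lintegral_map (hm n) (measurable_pi_apply n)]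

/-- Costs can be compared block by block. -/
theorem cost_le_cost {Γ Γ' : Incentive S A} {π : Policy M} (N : ℕ) [NeZero N]
    (h : ∀ k s, total (fun t s a => (Γ (k * N + t) s a : ℝ)) N (fun t => π (k * N + t)) s ≤
      total (fun t s a => (Γ' (k * N + t) s a : ℝ)) N (fun t => π (k * N + t)) s) :
    cost M Γ π ≤ cost M Γ' π := by
  have hnn : ∀ (Γ : Incentive S A) n,
      0 ≤ mean (pairLaw π M.init n) fun x => (Γ n x.1 x.2 : ℝ) := fun Γ n =>
    Finset.sum_nonneg fun x _ => mul_nonneg ENNReal.toReal_nonneg (Γ n x.1 x.2).2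
  have hb : ∀ (Γ : Incentive S A) k, ∑ t ∈ Finset.range N,
      mean (pairLaw π M.init (k * N + t)) (fun x => (Γ (k * N + t) x.1 x.2 : ℝ)) =
      mean (stateLaw π M.init (k * N)) fun s =>
        total (fun t s a => (Γ (k * N + t) s a : ℝ)) N (fun t => π (k * N + t)) s := by
    intro Γ k
    simp only [total, pairLaw_add, mean_bind, mean_finsetSum]
  have hsum : ∀ K, ∑ n ∈ Finset.range (K * N),
      mean (pairLaw π M.init n) (fun x => (Γ n x.1 x.2 : ℝ)) ≤
      ∑ n ∈ Finset.range (K * N), mean (pairLaw π M.init n) fun x => (Γ' n x.1 x.2 : ℝ) := by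
    intro K
    induction K with
    | zero => simp
    | succ K ih =>
      rw [Nat.succ_mul, Finset.sum_range_add, Finset.sum_range_add, hb, hb]
      exact add_le_add ih (mean_mono fun s _ => h K s)
  have htop : Filter.Tendsto (fun K => K * N) Filter.atTop Filter.atTop :=
    Filter.tendsto_id.atTop_mul_const' (Nat.pos_of_neZero N)
  -- Both series have nonnegative terms, so partial sums over whole blocks determine their values.
  rw [cost_eq_tsum, cost_eq_tsum, ENNReal.tsum_eq_iSup_nat' htop, ENNReal.tsum_eq_iSup_nat' htop]
  refine iSup_mono fun K => ?_
  rw [← ENNReal.ofReal_sum_of_nonneg fun n _ => hnn Γ n,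
    ← ENNReal.ofReal_sum_of_nonneg fun n _ => hnn Γ' n]
  exact ENNReal.ofReal_le_ofReal (hsum K)

/-- In each block, reward plus compensation equals `W 0 s`, while reward plus `Γ` is at least what
the reward-optimal policy `g` earns, hence at least `W 0 s`. Cancel the reward. -/
theorem AgentOptimal.cost_compensation_le (hf : ∀ s a, M.next s a = PMF.pure (f s a))
    {W : ℕ → S → ℝ} {N : ℕ} [NeZero N] (hW : IsValue M f N (fun _ => M.reward) W)
    {Γ : Incentive S A} {π : Policy M} (h : AgentOptimal M N Γ π) :
    cost M (compensation M f W N) π ≤ cost M Γ π := by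
  refine cost_le_cost N fun k s => ?_
  obtain ⟨g, hg⟩ := hW.exists_total_eq hf
  have h1 := total_payoff_compensation hf hW k (fun t => π (k * N + t)) s
  have h2 := h.total_le k s g
  have h3 : total (fun _ => M.reward) N g s ≤ total (payoff M N Γ k) N g s :=
    total_mono g s fun t _ s a _ => le_add_of_nonneg_right (Γ (k * N + t) s a).2
  rw [hg] at h3
  have h4 : ∀ Γ : Incentive S A, total (payoff M N Γ k) N (fun t => π (k * N + t)) s =
      total (fun _ => M.reward) N (fun t => π (k * N + t)) s +
      total (fun t s a => (Γ (k * N + t) s a : ℝ)) N (fun t => π (k * N + t)) s :=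
    fun Γ => total_add _ _ _ _ _
  rw [h4] at h1 h2
  linarith

end Design

end IncentiveDesign
-- Good prefixes and enforcing a path
namespace IncentiveDesign

/-- A word satisfying a co-safe formula has a good prefix. -/
theorem SCLTL.Sat.exists_prefix {AP : Type*} {φ : SCLTL AP} {w : ℕ → Set AP} (h : φ.Sat w) :
    ∃ n, ∀ w' : ℕ → Set AP, (∀ i < n, w' i = w i) → φ.Sat w' := by
  induction φ generalizing w with
  | tt => exact ⟨0, fun _ _ => trivial⟩
  | atom p => exact ⟨1, fun w' hw' => by rw [SCLTL.Sat, hw' 0 one_pos]; exact h⟩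
  | natom p => exact ⟨1, fun w' hw' => by rw [SCLTL.Sat, hw' 0 one_pos]; exact h⟩
  | and φ ψ ihφ ihψ =>
    obtain ⟨m, hm⟩ := ihφ h.1
    obtain ⟨n, hn⟩ := ihψ h.2
    exact ⟨max m n, fun w' hw' => ⟨hm w' fun i hi => hw' i (hi.trans_le (le_max_left _ _)),
      hn w' fun i hi => hw' i (hi.trans_le (le_max_right _ _))⟩⟩
  | or φ ψ ihφ ihψ =>
    rcases h with h | h
    · obtain ⟨m, hm⟩ := ihφ h
      exact ⟨m, fun w' hw' => Or.inl (hm w' hw')⟩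
    · obtain ⟨m, hm⟩ := ihψ h
      exact ⟨m, fun w' hw' => Or.inr (hm w' hw')⟩
  | next φ ih =>
    obtain ⟨m, hm⟩ := ih h
    exact ⟨m + 1, fun w' hw' => hm _ fun i hi => hw' (i + 1) (by omega)⟩
  | eventually φ ih =>
    obtain ⟨j, hj⟩ := h
    obtain ⟨m, hm⟩ := ih hj
    exact ⟨m + j, fun w' hw' => ⟨j, hm _ fun i hi => hw' (i + j) (by omega)⟩⟩
  -- The remaining case is `until`.
  | _ =>
    rename_i φ ψ ihφ ihψ
    obtain ⟨j, hj, hlt⟩ := h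
    obtain ⟨m, hm⟩ := ihψ hj
    have H : ∀ i, ∃ n, i < j → ∀ w' : ℕ → Set AP, (∀ l < n, w' l = w (l + i)) → φ.Sat w' := by
      intro i
      by_cases hi : i < j
      · obtain ⟨n, hn⟩ := ihφ (hlt i hi)
        exact ⟨n, fun _ => hn⟩
      · exact ⟨0, fun h => absurd h hi⟩
    choose n hn using H
    -- The length dominates `m + j` and each `n i + i` with `i < j`, the prefixes needed by the
    -- shifted words.
    refine ⟨(m + j) + (∑ i ∈ Finset.range j, n i + j), fun w' hw' => ⟨j, ?_, fun i hi => ?_⟩⟩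
    · exact hm _ fun i hi => hw' (i + j) (by omega)
    · refine hn i hi _ fun l hl => hw' (l + i) ?_
      have := Finset.single_le_sum (f := n) (fun _ _ => Nat.zero_le _) (Finset.mem_range.2 hi)
      omega

open Classical in
/-- The incentive design that compensates along the path `w` for the loss of value, with an extra
payment `δ`, during the first `L` stages, and pays nothing otherwise. -/
noncomputable def pathDesign {S A : Type*} (C : Incentive S A) (w : ℕ → S × A) (L : ℕ) (δ : ℝ≥0) :
    Incentive S A :=
  fun n s a => if n < L ∧ (s, a) = w n then C n s a + δ else 0

theorem pathDesign_self {S A : Type*} (C : Incentive S A) (w : ℕ → S × A) {L n : ℕ} (hn : n < L) (δ : ℝ≥0) :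
    pathDesign C w L δ n (w n).1 (w n).2 = C n (w n).1 (w n).2 + δ :=
  if_pos ⟨hn, rfl⟩

section Final

variable {S A AP : Type*} [Fintype S] [Fintype A] {M : MDP S A AP} {f : S → A → S}

/-- Pointwise the design pays at most the compensation, plus `δ` on the path; full compensation
would yield exactly `W 0 s`. -/
theorem total_pathDesign_le (hf : ∀ s a, M.next s a = PMF.pure (f s a)) {W : ℕ → S → ℝ} {N : ℕ}
    (hW : IsValue M f N (fun _ => M.reward) W) (w : ℕ → S × A) (L : ℕ) (δ : ℝ≥0) (k : ℕ)
    (σ : Policy M) (s : S) :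
    total (payoff M N (pathDesign (compensation M f W N) w L δ) k) N σ s ≤
      W 0 s + ∑ t ∈ Finset.range N, (pairLaw σ s t (w (k * N + t))).toReal * δ := by
  classical
  have h1 := total_payoff_compensation hf hW k σ s
  have h2 : ∑ t ∈ Finset.range N, (pairLaw σ s t (w (k * N + t))).toReal * δ =
      total (fun t s a => if (s, a) = w (k * N + t) then (δ : ℝ) else 0) N σ s := by
    refine Finset.sum_congr rfl fun t _ => ?_
    simp [mean]
  rw [← h1, h2, ← total_add]
  refine total_mono σ s fun t _ s a _ => ?_
  simp only [payoff, pathDesign]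
  have := NNReal.coe_nonneg (compensation M f W N (k * N + t) s a)
  have := NNReal.coe_nonneg δ
  split_ifs <;> first | (push_cast; linarith) | tauto

theorem IsPath.exists_total_pathDesign_eq (hf : ∀ s a, M.next s a = PMF.pure (f s a))
    {W : ℕ → S → ℝ} {N : ℕ} (hW : IsValue M f N (fun _ => M.reward) W) {w : ℕ → S × A}
    (hw : IsPath M f w) {K k : ℕ} (hk : k < K) (δ : ℝ≥0) :
    ∃ σ : Policy M,
      total (payoff M N (pathDesign (compensation M f W N) w (K * N) δ) k) N σ (w (k * N)).1 =
        W 0 (w (k * N)).1 + N * δ := by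
  obtain ⟨σ, hσ⟩ := (hw.shift (k * N)).exists_policy hf
  refine ⟨σ, ?_⟩
  rw [← total_payoff_compensation hf hW k σ]
  have hN : (N : ℝ) * δ = ∑ t ∈ Finset.range N, (δ : ℝ) := by simp
  rw [hN, total, total, ← Finset.sum_add_distrib]
  refine Finset.sum_congr rfl fun t ht => ?_
  have hlt : k * N + t < K * N := by
    have := Nat.mul_le_mul_right N (Nat.succ_le_of_lt hk)
    have := Finset.mem_range.1 ht
    rw [Nat.succ_mul] at *
    omega
  rw [add_zero] at hσ
  rw [hσ, mean_pure, mean_pure, payoff, payoff, pathDesign_self _ _ hlt]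
  push_cast
  ring

variable [MeasurableSpace S] [DiscreteMeasurableSpace S]
  [MeasurableSpace A] [DiscreteMeasurableSpace A]

/-- Following `w` gains `N * δ` over `W 0`, while any policy gains at most `δ` times the sum of the
`N` probabilities `p t ≤ 1` of being on `w`. With `δ > 0`, optimality forces each `p t` to be 1. -/
theorem AgentOptimal.pairLaw_block_eq (hf : ∀ s a, M.next s a = PMF.pure (f s a))
    {W : ℕ → S → ℝ} {N : ℕ} [NeZero N] (hW : IsValue M f N (fun _ => M.reward) W)
    {w : ℕ → S × A} (hw : IsPath M f w) {K k : ℕ} (hk : k < K) {δ : ℝ≥0} (hδ : 0 < δ)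
    {π : Policy M} (h : AgentOptimal M N (pathDesign (compensation M f W N) w (K * N) δ) π)
    {t : ℕ} (ht : t < N) :
    pairLaw (fun t => π (k * N + t)) (w (k * N)).1 t = PMF.pure (w (k * N + t)) := by
  obtain ⟨σ, hσ⟩ := hw.exists_total_pathDesign_eq hf hW hk δ
  have h1 := h.total_le k (w (k * N)).1 σ
  have h2 := total_pathDesign_le hf hW w (K * N) δ k (fun t => π (k * N + t)) (w (k * N)).1
  rw [hσ] at h1
  set p : ℕ → ℝ := fun t =>
    (pairLaw (fun t => π (k * N + t)) (w (k * N)).1 t (w (k * N + t))).toReal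
  have hp1 : ∀ t, p t ≤ 1 := fun t =>
    ENNReal.toReal_le_of_le_ofReal zero_le_one (by simpa using PMF.coe_le_one _ _)
  have h3 : (N : ℝ) * δ ≤ (∑ t ∈ Finset.range N, p t) * δ := by
    rw [Finset.sum_mul]
    linarith
  have h4 : (N : ℝ) ≤ ∑ t ∈ Finset.range N, p t :=
    le_of_mul_le_mul_right h3 (NNReal.coe_pos.2 hδ)
  have h5 : 1 - p t ≤ ∑ t ∈ Finset.range N, (1 - p t) :=
    Finset.single_le_sum (f := fun t => 1 - p t) (fun t _ => sub_nonneg.2 (hp1 t))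
      (Finset.mem_range.2 ht)
  rw [Finset.sum_sub_distrib] at h5
  simp only [Finset.sum_const, Finset.card_range, nsmul_eq_mul, mul_one] at h5
  exact eq_pure_of_one_le_toReal (by linarith : 1 ≤ p t)

/-- Under the path design, every optimal response follows the path. -/
theorem AgentOptimal.pairLaw_eq (hf : ∀ s a, M.next s a = PMF.pure (f s a))
    {W : ℕ → S → ℝ} {N : ℕ} [NeZero N] (hW : IsValue M f N (fun _ => M.reward) W)
    {w : ℕ → S × A} (hw : IsPath M f w) {K : ℕ} {δ : ℝ≥0} (hδ : 0 < δ)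
    {π : Policy M} (h : AgentOptimal M N (pathDesign (compensation M f W N) w (K * N) δ) π)
    {n : ℕ} (hn : n < K * N) : pairLaw π (w 0).1 n = PMF.pure (w n) := by
  -- Chaining blocks: the last pair of a block lies on `w`, so the next block starts in the state
  -- where the block lemma applies.
  have hstate : ∀ k < K, stateLaw π (w 0).1 (k * N) = PMF.pure (w (k * N)).1 := by
    intro k
    induction k with
    | zero => intro _; rw [zero_mul, stateLaw]
    | succ k ih =>
      intro hk
      obtain ⟨m, hm⟩ := Nat.exists_eq_succ_of_ne_zero (NeZero.ne N)
      have hlt : m < N := by omega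
      rw [Nat.succ_mul, stateLaw_add, ih (by omega), PMF.pure_bind]
      have := h.pairLaw_block_eq hf hW hw (by omega : k < K) hδ hlt
      have hN : ∀ σ : Policy M, ∀ s, stateLaw σ s N = stateLaw σ s (m + 1) :=
        fun σ s => congrArg _ hm
      have hkN : k * N + N = k * N + m + 1 := by omega
      rw [hN, stateLaw_succ, this, PMF.pure_bind, hf, ← hw.succ, hkN]
  have hk : n / N < K := Nat.div_lt_of_lt_mul (by rwa [mul_comm])
  have ht : n % N < N := Nat.mod_lt _ (Nat.pos_of_neZero N)
  have := h.pairLaw_block_eq hf hW hw hk hδ ht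
  have hd : n / N * N + n % N = n := Nat.div_add_mod' n N
  rw [← hd, pairLaw_add, hstate _ hk, PMF.pure_bind, this]

theorem satProb_eq_one {φ : SCLTL AP} {w : ℕ → S × A} (h0 : (w 0).1 = M.init) {n : ℕ}
    (hn : ∀ w' : ℕ → Set AP, (∀ i < n, w' i = M.label (w i).1) → φ.Sat w') {π : Policy M}
    (hπ : ∀ i < n, pairLaw π (w 0).1 i = PMF.pure (w i)) : satProb M φ π = 1 := by
  refine le_antisymm prob_le_one ?_
  have h1 : ∀ᵐ ω ∂(pathMeasure π M.init), ∀ i < n, ω i = w i :=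
    ae_all_iff.2 fun i => Filter.eventually_imp_distrib_left.2 fun hi =>
      ae_eq_of_pairLaw_eq_pure (h0 ▸ hπ i hi)
  rw [← measure_univ (μ := pathMeasure π M.init), satProb]
  -- An almost sure inclusion suffices, so the satisfaction event need not be shown measurable.
  refine measure_mono_ae ?_
  filter_upwards [h1] with ω hω _
  exact hn _ fun i hi => by rw [hω i hi]

theorem satProb_le_one (φ : SCLTL AP) (π : Policy M) : satProb M φ π ≤ 1 := prob_le_one

theorem cost_pathDesign_le {w : ℕ → S × A} (h0 : (w 0).1 = M.init) (C : Incentive S A) {L : ℕ}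
    (δ : ℝ≥0) {π : Policy M} (hπ : ∀ n < L, pairLaw π (w 0).1 n = PMF.pure (w n)) :
    cost M (pathDesign C w L δ) π ≤
      ∑ n ∈ Finset.range L, (C n (w n).1 (w n).2 : ℝ≥0∞) + L * δ := by
  have h1 : ∀ᵐ ω ∂(pathMeasure π M.init), ∀ i < L, ω i = w i :=
    ae_all_iff.2 fun i => Filter.eventually_imp_distrib_left.2 fun hi =>
      ae_eq_of_pairLaw_eq_pure (h0 ▸ hπ i hi)
  have h2 : ∀ᵐ ω ∂(pathMeasure π M.init),
      ∑' t, (pathDesign C w L δ t (ω t).1 (ω t).2 : ℝ≥0∞) ≤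
        ∑ n ∈ Finset.range L, (C n (w n).1 (w n).2 : ℝ≥0∞) + L * δ := by
    filter_upwards [h1] with ω hω
    rw [tsum_eq_sum (s := Finset.range L)]
    · have hL : (L : ℝ≥0∞) * δ = ∑ n ∈ Finset.range L, (δ : ℝ≥0∞) := by simp
      rw [hL, ← Finset.sum_add_distrib]
      refine Finset.sum_le_sum fun n hn => ?_
      rw [hω n (Finset.mem_range.1 hn), pathDesign_self _ _ (Finset.mem_range.1 hn),
        ENNReal.coe_add]
    · intro n hn
      rw [pathDesign, if_neg fun h => hn (Finset.mem_range.2 h.1), ENNReal.coe_zero]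
  refine (lintegral_mono_ae h2).trans ?_
  simp

/-- A policy that satisfies the formula almost surely has a satisfying path on which the
incentives do not exceed the cost. -/
theorem exists_path_tsum_le_cost (hf : ∀ s a, M.next s a = PMF.pure (f s a)) {φ : SCLTL AP}
    {π : Policy M} (h : satProb M φ π = 1) (Γ : Incentive S A) :
    ∃ w, IsPath M f w ∧ (w 0).1 = M.init ∧ (φ.Sat fun k => M.label (w k).1) ∧
      ∑' n, (Γ n (w n).1 (w n).2 : ℝ≥0∞) ≤ cost M Γ π := by
  have hm : ∀ n, Measurable fun x : S × A => (Γ n x.1 x.2 : ℝ≥0∞) := fun n => .of_discrete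
  have hg : Measurable fun ω : ℕ → S × A => ∑' n, (Γ n (ω n).1 (ω n).2 : ℝ≥0∞) :=
    Measurable.tsum fun n => (hm n).comp (measurable_pi_apply n)
  -- Otherwise the total payment would almost surely exceed its own mean.
  by_contra! H
  have hae : ∀ᵐ ω ∂(pathMeasure π M.init), (φ.Sat fun k => M.label (ω k).1) →
      cost M Γ π < ∑' n, (Γ n (ω n).1 (ω n).2 : ℝ≥0∞) := by
    filter_upwards [ae_isPath hf π M.init] with ω hω hsat
    exact H ω hω.2 hω.1 hsat
  have hB : MeasurableSet {ω : ℕ → S × A | cost M Γ π < ∑' n, (Γ n (ω n).1 (ω n).2 : ℝ≥0∞)} :=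
    measurableSet_lt measurable_const hg
  have hB1 : pathMeasure π M.init
      {ω | cost M Γ π < ∑' n, (Γ n (ω n).1 (ω n).2 : ℝ≥0∞)} = 1 := by
    refine le_antisymm prob_le_one ?_
    rw [← h]
    -- The satisfaction event has full measure and is almost surely contained in the measurable set
    -- of `hB`.
    exact measure_mono_ae hae
  have hB0 := (prob_compl_eq_zero_iff hB).2 hB1
  obtain ⟨ω, hω, hle⟩ := exists_notMem_null_le_lintegral hg.aemeasurable hB0
  rw [Set.mem_compl_iff, not_not] at hω
  exact (lt_irrefl _ (lt_of_lt_of_le hω hle))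

end Final

end IncentiveDesign

/-! ### Existence of an ε-optimal design -/

namespace IncentiveDesign

section Existence

variable {S A AP : Type*} [Fintype S] [Fintype A] {M : MDP S A AP} {f : S → A → S}
  [MeasurableSpace S] [DiscreteMeasurableSpace S]
  [MeasurableSpace A] [DiscreteMeasurableSpace A]

/-- Every policy satisfies the formula with probability 0, so the zero design is already optimal. -/
theorem exists_isEpsOptimal_of_not_sat (hf : ∀ s a, M.next s a = PMF.pure (f s a)) (N : ℕ)
    [NeZero N] {φ : SCLTL AP} (ε : ℝ≥0)
    (h : ¬∃ w, IsPath M f w ∧ (w 0).1 = M.init ∧ φ.Sat fun k => M.label (w k).1) :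
    ∃ Γ : Incentive S A, IsEpsOptimal M N φ ε Γ := by
  have h0 : ∀ σ : Policy M, satProb M φ σ = 0 := by
    intro σ
    rw [satProb, measure_eq_zero_iff_ae_notMem]
    filter_upwards [ae_isPath hf σ M.init] with ω hω hs
    exact h ⟨ω, hω.2, hω.1, hs⟩
  have hc : ∀ π : Policy M, cost M (fun _ _ _ => 0) π = 0 := fun π => by simp [cost]
  refine ⟨fun _ _ _ => 0, exists_agentOptimal hf N _, fun π hπ => ⟨hπ, fun σ => ?_⟩,
    fun π _ => ?_, fun π _ => ?_⟩
  · rw [h0, h0]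
  · rw [hc]
    exact ENNReal.zero_lt_top
  · rw [hc]
    exact zero_le

theorem exists_satProb_eq_one (hf : ∀ s a, M.next s a = PMF.pure (f s a)) {φ : SCLTL AP}
    {w : ℕ → S × A} (hw : IsPath M f w) (h0 : (w 0).1 = M.init)
    (hs : φ.Sat fun k => M.label (w k).1) : ∃ π : Policy M, satProb M φ π = 1 := by
  obtain ⟨π, hπ⟩ := hw.exists_policy hf
  obtain ⟨n, hn⟩ := hs.exists_prefix
  exact ⟨π, satProb_eq_one h0 hn fun i _ => hπ i⟩

/-- Some satisfying path can be compensated at a cost arbitrarily close to the optimal one. -/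
theorem exists_path_tsum_compensation_le (hf : ∀ s a, M.next s a = PMF.pure (f s a))
    {W : ℕ → S → ℝ} {N : ℕ} [NeZero N] (hW : IsValue M f N (fun _ => M.reward) W)
    {φ : SCLTL AP} {η : ℝ≥0} (hη : 0 < η)
    (h : ∃ w, IsPath M f w ∧ (w 0).1 = M.init ∧ φ.Sat fun k => M.label (w k).1) :
    ∃ w, IsPath M f w ∧ (w 0).1 = M.init ∧ (φ.Sat fun k => M.label (w k).1) ∧
      ∑' n, (compensation M f W N n (w n).1 (w n).2 : ℝ≥0∞) ≤ optimalCost M N φ + η := by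
  obtain ⟨v, hv, hv0, hvs⟩ := h
  by_cases htop : optimalCost M N φ = ∞
  · exact ⟨v, hv, hv0, hvs, by simp [htop]⟩
  have hlt : optimalCost M N φ < optimalCost M N φ + η :=
    ENNReal.lt_add_right htop (by simpa using hη.ne')
  conv_lhs at hlt => rw [optimalCost]
  simp only [iInf_lt_iff] at hlt
  obtain ⟨Γ, π, hF, hlt⟩ := hlt
  obtain ⟨σ, hσ⟩ := exists_satProb_eq_one hf hv hv0 hvs
  -- Feasibility means maximal probability, and `σ`, which follows `v`, attains 1.
  have h1 : satProb M φ π = 1 := (satProb_le_one φ π).antisymm (hσ ▸ hF.2 σ)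
  obtain ⟨w, hw, hw0, hws, hle⟩ := exists_path_tsum_le_cost hf h1 (compensation M f W N)
  exact ⟨w, hw, hw0, hws, hle.trans ((hF.1.cost_compensation_le hf hW).trans hlt.le)⟩

/-- Half of `ε` pays for the choice of a nearly optimal path, the other half for the bonuses. -/
theorem exists_isEpsOptimal_of_sat (hf : ∀ s a, M.next s a = PMF.pure (f s a)) (N : ℕ)
    [NeZero N] {φ : SCLTL AP} {ε : ℝ≥0} (hε : 0 < ε)
    (h : ∃ w, IsPath M f w ∧ (w 0).1 = M.init ∧ φ.Sat fun k => M.label (w k).1) :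
    ∃ Γ : Incentive S A, IsEpsOptimal M N φ ε Γ := by
  obtain ⟨W, hW⟩ := exists_isValue M f N fun _ => M.reward
  obtain ⟨w, hw, hw0, hws, hle⟩ := exists_path_tsum_compensation_le hf hW (half_pos hε) h
  obtain ⟨K, hK⟩ := hws.exists_prefix
  obtain ⟨δ, hδ, hδε⟩ : ∃ δ : ℝ≥0, 0 < δ ∧ (K * N : ℕ) * δ ≤ ε / 2 := by
    -- The `+ 1` covers `K = 0`, when the empty prefix is already good.
    refine ⟨ε / 2 / ((K * N : ℕ) + 1), by positivity, ?_⟩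
    rw [mul_div_assoc', div_le_iff₀ (by positivity), mul_comm]
    gcongr
    exact le_self_add
  -- A good prefix of length `K` fits inside `K` whole blocks.
  have hKN : K ≤ K * N := Nat.le_mul_of_pos_right K (Nat.pos_of_neZero N)
  set Γ := pathDesign (compensation M f W N) w (K * N) δ
  have hlaw : ∀ π : Policy M, AgentOptimal M N Γ π →
      ∀ n < K * N, pairLaw π (w 0).1 n = PMF.pure (w n) :=
    fun π hπ n hn => hπ.pairLaw_eq hf hW hw hδ hn
  have hcost : ∀ π : Policy M, AgentOptimal M N Γ π → cost M Γ π ≤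
      ∑ n ∈ Finset.range (K * N), (compensation M f W N n (w n).1 (w n).2 : ℝ≥0∞) +
        (K * N : ℕ) * δ :=
    fun π hπ => cost_pathDesign_le hw0 _ δ (hlaw π hπ)
  refine ⟨Γ, exists_agentOptimal hf N Γ, fun π hπ => ⟨hπ, fun σ => ?_⟩, fun π hπ => ?_,
    fun π hπ => ?_⟩
  · rw [satProb_eq_one hw0 hK fun i hi => hlaw π hπ i (hi.trans_le hKN)]
    exact satProb_le_one φ σ
  · refine (hcost π hπ).trans_lt (ENNReal.add_lt_top.2 ⟨?_, ?_⟩)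
    · exact ENNReal.sum_lt_top.2 fun n _ => ENNReal.coe_lt_top
    · exact ENNReal.mul_lt_top (ENNReal.natCast_lt_top _) ENNReal.coe_lt_top
  · have h2 : ((K * N : ℕ) : ℝ≥0∞) * δ ≤ ((ε / 2 : ℝ≥0) : ℝ≥0∞) := by
      exact_mod_cast hδε
    refine (hcost π hπ).trans ((add_le_add ((ENNReal.sum_le_tsum _).trans hle) h2).trans ?_)
    rw [add_assoc, ← ENNReal.coe_add, add_halves]

end Existence

end IncentiveDesign

theorem corollary1 {S A AP : Type*} [Fintype S] [Fintype A]
    [MeasurableSpace S] [DiscreteMeasurableSpace S]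
    [MeasurableSpace A] [DiscreteMeasurableSpace A]
    (M : IncentiveDesign.MDP S A AP)
    (hdet : ∀ s, ∀ a ∈ M.avail s, ∀ s', M.trans s a s' = 0 ∨ M.trans s a s' = 1)
    (N : ℕ) [NeZero N] (φ : IncentiveDesign.SCLTL AP) (ε : ℝ≥0) (hε : 0 < ε) :
    ∃ Γ : IncentiveDesign.Incentive S A, IncentiveDesign.IsEpsOptimal M N φ ε Γ := by
  obtain ⟨f, hf⟩ := IncentiveDesign.exists_next_eq_pure M hdet
  by_cases h : ∃ w, IncentiveDesign.IsPath M f w ∧ (w 0).1 = M.init ∧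
      φ.Sat fun k => M.label (w k).1
  · exact IncentiveDesign.exists_isEpsOptimal_of_sat hf N hε h
  · exact IncentiveDesign.exists_isEpsOptimal_of_not_sat hf N ε h
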